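/- All graphs are finite and simple. A \emph{cover} of a graph $G$ is a pair $\mathcal H=(L,H)$ of a graph $H$ and a function $L$ from $V(G)$ to the subsets of $V(H)$ such that (1) the sets $L(u)$, $u\in V(G)$, partition $V(H)$; (2) each $L(u)$ is a clique in $H$; (3) if $H$ has an edge between $L(u)$ and $L(v)$, then $u=v$ or $uv\in E(G)$; (4) if $uv\in E(G)$, the edges of $H$ between $L(u)$ and $L(v)$ form a (possibly empty) matching. The cover is \emph{$m$-fold} if $|L(u)|=m$ for all $u$, and an \emph{$\mathcal H$-coloring} of $G$ is an independent set of $H$ of size $|V(G)|$. For a positive integer $m$, the \emph{DP color function} $P_{DP}(G,m)$ is the minimum, over all $m$-fold covers $\mathcal H$ of $G$, of the number of $\mathcal H$-colorings of $G$, and $P(G,m)$ is the number of proper $m$-colorings of $G$. The \emph{Theta graph} $\Theta(l_1,l_2,l_3)$ consists of two end vertices joined by three internally disjoint paths of lengths $l_1,l_2,l_3$. \textbf{Theorem.} Let $G=\Theta(l_1,l_2,l_3)$ with $2\le l_1\le l_2\le l_3$. (i) If the parity of $l_1$ is different from that of both $l_2$ and $l_3$, then $P_{DP}(G,m)=P(G,m)$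 for all integers $m\ge 1$. (ii) If the parity of $l_1$ is the same as that of $l_2$ and different from that of $l_3$, then for all integers $m\ge 2$ \[P_{DP}(G,m)=\frac1m\left[(m-1)^{l_1+l_2+l_3}+(m-1)^{l_1}-(m-1)^{l_2+1}-(m-1)^{l_3}+(-1)^{l_3+1}(m-2)\right].\] (iii) If the parity of $l_1$ is the same as that of $l_3$ and different from that of $l_2$, then for all integers $m\ge 2$ \[P_{DP}(G,m)=\frac1m\left[(m-1)^{l_1+l_2+l_3}+(m-1)^{l_1}-(m-1)^{l_3+1}-(m-1)^{l_2}+(-1)^{l_2+1}(m-2)\right].\] (iv) If $l_1,l_2,l_3$ all have the same parity, then for all integers $m\ge 3$ \[P_{DP}(G,m)=\frac1m\left[(m-1)^{l_1+l_2+l_3}-(m-1)^{l_1}-(m-1)^{l_2}-(m-1)^{l_3}+2(-1)^{l_1+l_2+l_3}\right].\] -/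

import Mathlib

universe u

namespace DPColoring

/-- A cover `(L, H)` of the graph `G`: a finite graph `H` on a vertex set `W`, with a list
`L v ⊆ W` for every vertex `v` of `G`, such that the lists partition `W`, every list is a clique
of `H`, edges of `H` between different lists occur only over edges of `G`, and over every edge
of `G` they form a (possibly empty) matching.
(Every cover of a finite graph has finitely many vertices, so letting `W` range over the
universe of `V` loses none of them up to isomorphism.) -/
structure Cover {V : Type u} (G : SimpleGraph V) where
  /-- The vertex set of `H`. -/
  W : Type u
  finite_W : Finite W
  H : SimpleGraph W
  L : V → Set W
  nonempty : ∀ v, (L v).Nonempty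
  partition : ∀ x : W, ∃! v : V, x ∈ L v
  clique : ∀ v, H.IsClique (L v)
  adj_of_cross : ∀ u v : V, ∀ x ∈ L u, ∀ y ∈ L v, H.Adj x y → u = v ∨ G.Adj u v
  /-- Since `u` and `v` may be exchanged, this says that no two edges of `H` between `L u` and
  `L v` share an end, on either side. -/
  matching : ∀ u v : V, G.Adj u v →
    ∀ x ∈ L u, ∀ y ∈ L v, ∀ z ∈ L v, H.Adj x y → H.Adj x z → y = z

namespace Cover

variable {V : Type u} {G : SimpleGraph V}

/-- The cover is `m`-fold: every list has exactly `m` elements. -/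
def IsFold (C : Cover G) (m : ℕ) : Prop :=
  ∀ v, (C.L v).ncard = m

/-- The colorings of `G` by the cover: the independent sets of `H` of size `|V(G)|`. -/
def colorings (C : Cover G) : Set (Finset C.W) :=
  {I | C.H.IsNIndepSet (Nat.card V) I}

/-- The number of colorings of `G` by the cover. -/
noncomputable def numColorings (C : Cover G) : ℕ :=
  C.colorings.ncard

/-- For `m ≥ 1` every finite graph has an `m`-fold cover. -/
theorem exists_isFold [Finite V] (G : SimpleGraph V) (m : ℕ) (hm : 1 ≤ m) :
    ∃ C : Cover G, C.IsFold m := by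
  refine ⟨{ W := V × Fin m
            finite_W := inferInstance
            H := SimpleGraph.fromRel fun x y => x.1 = y.1
            L := fun v => {x | x.1 = v}
            nonempty := fun v => ⟨(v, ⟨0, hm⟩), rfl⟩
            partition := fun x => ⟨x.1, rfl, fun v h => h.symm⟩
            clique := ?_
            adj_of_cross := ?_
            matching := ?_ }, ?_⟩
  · intro v x hx y hy hne
    simp_all [SimpleGraph.fromRel_adj]
  · intro u v x hx y hy h
    simp_all [SimpleGraph.fromRel_adj]
    grind
  · intro u v huv x hx y hy z hz h
    have := huv.ne
    simp_all [SimpleGraph.fromRel_adj]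
  · intro v
    have : {x : V × Fin m | x.1 = v} = Set.range (fun j : Fin m => (v, j)) := by
      ext ⟨a, b⟩
      simp [eq_comm]
    change Set.ncard {x : V × Fin m | x.1 = v} = m
    rw [this, ← Set.image_univ, Set.ncard_image_of_injective _ (Prod.mk_right_injective v)]
    simp

end Cover

/-- The DP color function `P_DP(G, m)`: the minimum, over all `m`-fold covers of `G`, of the number
of colorings of `G` by the cover (`m ≥ 1`). -/
noncomputable def dpColorFunction {V : Type u} (G : SimpleGraph V) (m : ℕ) : ℕ :=
  sInf {n | ∃ C : Cover G, C.IsFold m ∧ C.numColorings = n}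

/-- For `m ≥ 1` the value of the DP color function of a finite graph is a genuine minimum. -/
theorem dpColorFunction_isLeast {V : Type u} [Finite V] (G : SimpleGraph V) (m : ℕ)
    (hm : 1 ≤ m) :
    IsLeast {n | ∃ C : Cover G, C.IsFold m ∧ C.numColorings = n} (dpColorFunction G m) := by
  obtain ⟨C, hC⟩ := Cover.exists_isFold G m hm
  exact ⟨Nat.sInf_mem ⟨_, C, hC, rfl⟩, fun n hn => Nat.sInf_le hn⟩

/-- The chromatic polynomial `P(G, m)`: the number of proper `m`-colorings of `G`. -/
noncomputable def chromaticPolynomial {V : Type u} (G : SimpleGraph V) (m : ℕ) : ℕ :=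
  Nat.card (G.Coloring (Fin m))

/-- The vertices of a Theta graph with paths of lengths `l 0, l 1, l 2`: two end vertices
`inl false`, `inl true`, and `l i - 1` internal vertices on the `i`-th path. -/
abbrev ThetaVertex (l : Fin 3 → ℕ) : Type :=
  Bool ⊕ (Σ i : Fin 3, Fin (l i - 1))

/-- The `j`-th vertex of the `i`-th path, `0 ≤ j ≤ l i`; the values at `j = 0` and `j ≥ l i` are
the two end vertices. -/
def thetaPoint (l : Fin 3 → ℕ) (i : Fin 3) (j : ℕ) : ThetaVertex l :=
  if j = 0 then Sum.inl false
  else if h : j - 1 < l i - 1 then Sum.inr ⟨i, ⟨j - 1, h⟩⟩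
  else Sum.inl true

/-- The Theta graph `Θ(l₁, l₂, l₃)`: two end vertices joined by three internally disjoint paths
of lengths `l₁, l₂, l₃` (all positive, at most one of them equal to `1`). -/
def thetaGraph (l₁ l₂ l₃ : ℕ) : SimpleGraph (ThetaVertex ![l₁, l₂, l₃]) :=
  SimpleGraph.fromRel fun x y => ∃ i : Fin 3, ∃ j : ℕ, j < ![l₁, l₂, l₃] i ∧
    x = thetaPoint ![l₁, l₂, l₃] i j ∧ y = thetaPoint ![l₁, l₂, l₃] i (j + 1)

end DPColoring

/-! Write `B k` for `unmatchedCount m k` and `s k = (-1) ^ k`. If the colors along a path of length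
`k` are matched by permutations with composition `π`, the number of colorings with end colors `a`,
`b` is `B k + s k * [π a = b]` (`card_pathColoring`). Hence only the three composed permutations
matter for a Theta graph. Fix the color `a` of the first end and let `x i` be its image along path
`i`. Summing over the color of the other end (`sum_prod_add_mul_ite`) gives a weight depending only
on which of `x 0`, `x 1`, `x 2` coincide: a constant, plus `s i * s j * B k` for each coincidence `x
i = x j` (with `k` the third path), plus `s 0 * s 1 * s 2` if all agree.

Enlarging the matchings to perfect ones only destroys colorings, so every cover is bounded below by
such a sum over `a`, hence by `m` times the least weight. Equality holds as soon as three
permutations realize the optimal coincidence pattern at every `a` simultaneously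
(`dpColorFunction_eq`). The parities fix the signs, and comparing the values `B k` gives the
optimum: all equal in (i), which is the trivial cover; `x 0 = x 2 ≠ x 1` in (ii); `x 0 = x 1 ≠ x 2`
in (iii); all distinct in (iv), hence `m ≥ 3` there. -/

namespace DPColoring

open Equiv

/-! ### Colorings of a path with prescribed end colors -/

section PathCounting

variable {m n : ℕ}

/-- The `j`-th entry of the sequence `a, p 0, …, p (n - 1), b, b, …`. -/
def pathPoint (a : Fin m) (p : Fin n → Fin m) (b : Fin m) (j : ℕ) : Fin m :=
  if j = 0 then a else if h : j - 1 < n then p ⟨j - 1, h⟩ else b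

theorem pathPoint_cons_succ (a x : Fin m) (p : Fin n → Fin m) (b : Fin m) (j : ℕ) :
    pathPoint a (Fin.cons x p : Fin (n + 1) → Fin m) b (j + 1) = pathPoint x p b j := by
  cases j with
  | zero => rfl
  | succ k =>
    unfold pathPoint
    rw [if_neg (Nat.succ_ne_zero _), if_neg (Nat.succ_ne_zero _)]
    by_cases h : k < n
    · rw [dif_pos (show k + 1 + 1 - 1 < n + 1 by omega), dif_pos (show k + 1 - 1 < n by omega)]
      rfl
    · rw [dif_neg (show ¬ k + 1 + 1 - 1 < n + 1 by omega),
        dif_neg (show ¬ k + 1 - 1 < n by omega)]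

/-- Colorings of a path with `n` internal vertices whose ends are colored `a` and `b`, where the
colors over the `j`-th edge are matched by `σ j`. -/
abbrev PathColoring (n : ℕ) (σ : ℕ → Perm (Fin m)) (a b : Fin m) : Type :=
  {p : Fin n → Fin m // ∀ j ≤ n, σ j (pathPoint a p b j) ≠ pathPoint a p b (j + 1)}

/-- The composition `σ (k - 1) * ⋯ * σ 0`. -/
def pathPerm : ℕ → (ℕ → Perm (Fin m)) → Perm (Fin m)
  | 0, _ => 1
  | k + 1, σ => pathPerm k (fun j => σ (j + 1)) * σ 0

theorem pathPerm_eq_head (σ : ℕ → Perm (Fin m)) (hσ : ∀ j, σ (j + 1) = 1) (k : ℕ) :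
    pathPerm (k + 1) σ = σ 0 := by
  have h : ∀ k, pathPerm k (fun _ => (1 : Perm (Fin m))) = 1 := fun k => by
    induction k with
    | zero => rfl
    | succ k ih => simp [pathPerm, ih]
  simp [pathPerm, hσ, h]

/-- The number of colorings of a path of length `k` whose ends have two prescribed, unmatched
colors. -/
def unmatchedCount (m : ℕ) : ℕ → ℤ
  | 0 => 0
  | k + 1 => (m - 1) * unmatchedCount m k + (-1) ^ k

theorem mul_unmatchedCount (m k : ℕ) :
    (m : ℤ) * unmatchedCount m k = (m - 1) ^ k - (-1) ^ k := by
  induction k with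
  | zero => simp [unmatchedCount]
  | succ k ih =>
    rw [unmatchedCount, mul_add, mul_left_comm, ih]
    ring

/-- Splitting off the first internal vertex of a path. -/
def pathColoringSuccEquiv (σ : ℕ → Perm (Fin m)) (a b : Fin m) :
    PathColoring (n + 1) σ a b ≃
      Σ x : {x : Fin m // σ 0 a ≠ x}, PathColoring n (fun j => σ (j + 1)) x.1 b where
  toFun p := ⟨⟨p.1 0, by simpa [pathPoint] using p.2 0 (by omega)⟩, Fin.tail p.1, fun j hj => by
    have := p.2 (j + 1) (by omega)
    rw [← Fin.cons_self_tail p.1] at this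
    simpa only [pathPoint_cons_succ] using this⟩
  invFun q := ⟨Fin.cons q.1.1 q.2.1, fun j hj => by
    cases j with
    | zero => simpa [pathPoint] using q.1.2
    | succ j =>
      simp only [pathPoint_cons_succ]
      exact q.2.2 j (by omega)⟩
  left_inv p := by simp
  right_inv q := by
    obtain ⟨⟨x, hx⟩, p, hp⟩ := q
    rfl

/-- Induction on the first internal vertex: its color ranges over everything except `σ 0 a`, so the
count is the full sum minus one term. That subtraction flips the sign of the correction. -/
theorem card_pathColoring (n : ℕ) (σ : ℕ → Perm (Fin m)) (a b : Fin m) :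
    (Nat.card (PathColoring n σ a b) : ℤ) =
      unmatchedCount m (n + 1) + (-1) ^ (n + 1) * if pathPerm (n + 1) σ a = b then 1 else 0 := by
  induction n generalizing σ a with
  | zero =>
    by_cases h : σ 0 a = b
    · have : IsEmpty (PathColoring 0 σ a b) := ⟨fun p => p.2 0 le_rfl (by simpa [pathPoint] using h)⟩
      simp [unmatchedCount, pathPerm, h]
    · have : Nonempty (PathColoring 0 σ a b) :=
        ⟨⟨Fin.elim0, fun j hj => by
          obtain rfl : j = 0 := by omega
          simpa [pathPoint] using h⟩⟩
      rw [Nat.card_unique]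
      simp [unmatchedCount, pathPerm, h]
  | succ n ih =>
    rw [Nat.card_congr (pathColoringSuccEquiv σ a b), Nat.card_sigma]
    push_cast
    simp only [ih]
    set f : Fin m → ℤ := fun x => unmatchedCount m (n + 1) + (-1) ^ (n + 1) *
      if pathPerm (n + 1) (fun j => σ (j + 1)) x = b then 1 else 0 with hf
    have h₁ : ∑ x : {x : Fin m // σ 0 a ≠ x}, f x.1 = ∑ x, f x - f (σ 0 a) := by
      rw [← Finset.sum_erase_eq_sub (Finset.mem_univ _)]
      exact (Finset.sum_subtype _ (by simp [eq_comm]) f).symm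
    -- The composed permutation is bijective, so exactly one `x` is matched to `b`.
    have h₂ : ∑ x, f x = m * unmatchedCount m (n + 1) + (-1) ^ (n + 1) := by
      simp only [hf, Finset.sum_add_distrib, ← Finset.mul_sum, ← Equiv.eq_symm_apply]
      simp
    rw [h₁, h₂, hf, unmatchedCount.eq_2 m (n + 1)]
    simp only [pathPerm.eq_2 σ (n + 1), Perm.mul_apply]
    ring

end PathCounting

/-! ### Assembling three paths into a Theta graph -/

section ThetaCounting

variable {m : ℕ} {l : Fin 3 → ℕ}

/-- The colorings of a Theta graph where the colors over the `j`-th edge of the `i`-th path are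
matched by `σ i j`. -/
def thetaColorings (l : Fin 3 → ℕ) (σ : Fin 3 → ℕ → Perm (Fin m)) :
    Set (ThetaVertex l → Fin m) :=
  {c | ∀ i, ∀ j < l i, σ i j (c (thetaPoint l i j)) ≠ c (thetaPoint l i (j + 1))}

theorem apply_thetaPoint (c : ThetaVertex l → Fin m) (i : Fin 3) (j : ℕ) :
    c (thetaPoint l i j) =
      pathPoint (c (Sum.inl false)) (fun k => c (Sum.inr ⟨i, k⟩)) (c (Sum.inl true)) j := by
  unfold thetaPoint pathPoint
  split_ifs <;> rfl

/-- A coloring of a Theta graph is given by the colors of the ends and colorings of the three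
paths. -/
def thetaColoringsEquiv (hl : ∀ i, 1 ≤ l i) (σ : Fin 3 → ℕ → Perm (Fin m)) :
    thetaColorings l σ ≃
      Σ ab : Fin m × Fin m, ∀ i, PathColoring (l i - 1) (σ i) ab.1 ab.2 where
  toFun c := ⟨(c.1 (Sum.inl false), c.1 (Sum.inl true)), fun i =>
    ⟨fun k => c.1 (Sum.inr ⟨i, k⟩), fun j hj => by
      have := c.2 i j (by have := hl i; omega)
      rwa [apply_thetaPoint c.1, apply_thetaPoint c.1] at this⟩⟩
  invFun q := ⟨Sum.elim (fun t => if t then q.1.2 else q.1.1) fun k => (q.2 k.1).1 k.2,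
    fun i j hj => by
      have := (q.2 i).2 j (by omega)
      rwa [apply_thetaPoint (Sum.elim _ _), apply_thetaPoint (Sum.elim _ _)]⟩
  left_inv c := by
    ext v : 2
    rcases v with (_ | _) | _ <;> rfl
  right_inv q := rfl

theorem ncard_thetaColorings (hl : ∀ i, 1 ≤ l i) (σ : Fin 3 → ℕ → Perm (Fin m)) :
    ((thetaColorings l σ).ncard : ℤ) = ∑ a, ∑ b, ∏ i, (unmatchedCount m (l i) +
      (-1) ^ l i * if pathPerm (l i) (σ i) a = b then 1 else 0) := by
  rw [← Nat.card_coe_set_eq, Nat.card_congr (thetaColoringsEquiv hl σ), Nat.card_sigma,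
    Fintype.sum_prod_type]
  push_cast
  refine Finset.sum_congr rfl fun a _ => Finset.sum_congr rfl fun b _ => ?_
  rw [Nat.card_pi]
  push_cast
  refine Finset.prod_congr rfl fun i _ => ?_
  rw [card_pathColoring, Nat.sub_add_cancel (hl i)]

/-- Summing the product of the path counts over the color of the second end. -/
theorem sum_prod_add_mul_ite (B s : Fin 3 → ℤ) (x : Fin 3 → Fin m) :
    ∑ b, ∏ i, (B i + s i * if x i = b then 1 else 0) =
      m * (B 0 * B 1 * B 2) + s 0 * B 1 * B 2 + s 1 * B 0 * B 2 + s 2 * B 0 * B 1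
      + (if x 0 = x 1 then s 0 * s 1 * B 2 else 0) + (if x 0 = x 2 then s 0 * s 2 * B 1 else 0)
      + (if x 1 = x 2 then s 1 * s 2 * B 0 else 0)
      + (if x 0 = x 1 ∧ x 0 = x 2 then s 0 * s 1 * s 2 else 0) := by
  have key : ∀ b, ∏ i, (B i + s i * if x i = b then 1 else 0) = B 0 * B 1 * B 2
      + (if x 0 = b then s 0 * B 1 * B 2 else 0) + (if x 1 = b then s 1 * B 0 * B 2 else 0)
      + (if x 2 = b then s 2 * B 0 * B 1 else 0)
      + (if x 0 = b then if x 0 = x 1 then s 0 * s 1 * B 2 else 0 else 0)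
      + (if x 0 = b then if x 0 = x 2 then s 0 * s 2 * B 1 else 0 else 0)
      + (if x 1 = b then if x 1 = x 2 then s 1 * s 2 * B 0 else 0 else 0)
      + (if x 0 = b then if x 0 = x 1 ∧ x 0 = x 2 then s 0 * s 1 * s 2 else 0 else 0) := by
    intro b
    rw [Fin.prod_univ_three]
    split_ifs <;> first | ring1 | (exfalso; grind)
  simp only [key, Finset.sum_add_distrib, Finset.sum_ite_eq, Finset.mem_univ, if_true,
    Finset.sum_const, Finset.card_univ, Fintype.card_fin, nsmul_eq_mul]

end ThetaCounting

/-! ### General covers, and covers given by permutations -/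

/-- A partial matching between two copies of a finite type is contained in a perfect one. -/
theorem exists_perm_of_matching {α : Type*} [Finite α] (M : α → α → Prop)
    (hr : ∀ a b c, M a b → M a c → b = c) (hl : ∀ a b c, M a c → M b c → a = b) :
    ∃ σ : Perm α, ∀ a b, M a b → σ a = b := by
  classical
  have := Fintype.ofFinite α
  -- The value off the domain of `M` is arbitrary: only the restriction to that domain is extended.
  let f : α → α := fun a => if h : ∃ b, M a b then h.choose else a
  have hf : ∀ a b, M a b → f a = b := fun a b h => by
    have h' : ∃ b, M a b := ⟨b, h⟩
    simp only [f, dif_pos h']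
    exact hr a _ _ h'.choose_spec h
  obtain ⟨g, hg⟩ := Finset.exists_equiv_extend_of_card_eq (α := α) (t := (Finset.univ : Finset α))
    rfl (s := Finset.univ.filter fun a => ∃ b, M a b) (f := f) (Finset.subset_univ _) (by
      intro a ha b hb hab
      simp only [Finset.coe_filter, Finset.mem_univ, true_and, Set.mem_ofPred_eq] at ha hb
      obtain ⟨c, hc⟩ := ha
      obtain ⟨d, hd⟩ := hb
      rw [hf _ _ hc, hf _ _ hd] at hab
      exact hl _ _ _ hc (hab ▸ hd))
  refine ⟨g.trans (Equiv.subtypeUnivEquiv Finset.mem_univ), fun a b h => ?_⟩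
  have := hg a (by simpa using ⟨b, h⟩)
  rw [hf a b h] at this
  simpa using this

namespace Cover

variable {V : Type u} {G : SimpleGraph V}

theorem eq_of_mem (C : Cover G) {x : C.W} {u v : V} (hu : x ∈ C.L u) (hv : x ∈ C.L v) : u = v :=
  (C.partition x).unique hu hv

/-- The choices of one element from each list with no two of them adjacent. -/
def transversals (C : Cover G) : Set (V → C.W) :=
  {c | (∀ v, c v ∈ C.L v) ∧ ∀ u v, G.Adj u v → ¬ C.H.Adj (c u) (c v)}

/-- An independent set meets each clique `C.L v` at most once, so having `Nat.card V` elements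
forces exactly one in each list. Disjointness of the lists makes the choice function recoverable
from the set. -/
theorem numColorings_eq [Finite V] (C : Cover G) : C.numColorings = C.transversals.ncard := by
  classical
  have := Fintype.ofFinite V
  have hinj : ∀ c ∈ C.transversals, Function.Injective c := fun c hc u v huv =>
    C.eq_of_mem (hc.1 u) (huv ▸ hc.1 v)
  have himage : C.colorings = (fun c : V → C.W => Finset.univ.image c) '' C.transversals := by
    ext I
    constructor
    · rintro ⟨hI, hcard⟩
      choose part hpart using fun x => (C.partition x).exists
      have hpi : Set.InjOn part I := fun x hx y hy hxy => by
        by_contra hne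
        exact hI hx hy hne (C.clique _ (hpart x) (hxy ▸ hpart y) hne)
      have himg : I.image part = Finset.univ := by
        rw [← Finset.card_eq_iff_eq_univ, Finset.card_image_of_injOn hpi, hcard,
          Nat.card_eq_fintype_card]
      have hex : ∀ v, ∃ x ∈ I, part x = v := fun v => by
        have hv := Finset.mem_univ v
        rwa [← himg, Finset.mem_image] at hv
      choose c hcI hc using hex
      have hcL : ∀ v, c v ∈ C.L v := fun v => by
        have hv := hpart (c v)
        rwa [hc] at hv
      have hcinj : Function.Injective c := Function.LeftInverse.injective hc
      refine ⟨c, ⟨hcL, fun u v huv =>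
        hI (hcI u) (hcI v) (hcinj.ne huv.ne)⟩, Finset.eq_of_subset_of_card_le ?_ ?_⟩
      · simpa [Finset.image_subset_iff] using hcI
      · rw [Finset.card_image_of_injective _ hcinj, hcard, Nat.card_eq_fintype_card,
          Finset.card_univ]
    · rintro ⟨c, hc, rfl⟩
      refine ⟨?_, ?_⟩
      · intro x hx y hy hxy hadj
        simp only [Finset.coe_image, Finset.coe_univ, Set.image_univ, Set.mem_range] at hx hy
        obtain ⟨u, rfl⟩ := hx
        obtain ⟨v, rfl⟩ := hy
        rcases C.adj_of_cross u v _ (hc.1 u) _ (hc.1 v) hadj with rfl | h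
        · exact hxy rfl
        · exact hc.2 u v h hadj
      · rw [Finset.card_image_of_injective _ (hinj c hc), Nat.card_eq_fintype_card,
          Finset.card_univ]
  rw [numColorings, himage]
  refine Set.InjOn.ncard_image ?_
  intro c hc d hd hcd
  ext v
  have : c v ∈ Finset.univ.image d := by
    rw [← show Finset.univ.image c = Finset.univ.image d from hcd]
    exact Finset.mem_image_of_mem _ (Finset.mem_univ v)
  obtain ⟨w, -, hw⟩ := Finset.mem_image.1 this
  obtain rfl := C.eq_of_mem (hd.1 w) (hw ▸ hc.1 v)
  exact hw.symm

/-- The cover of `G` in which the colors over the edge `uv` are matched by `τ u v`. -/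
def ofPerm [Finite V] (G : SimpleGraph V) {m : ℕ} (hm : 1 ≤ m) (τ : V → V → Perm (Fin m))
    (hτ : ∀ u v, τ v u = (τ u v)⁻¹) : Cover G where
  W := V × Fin m
  finite_W := inferInstance
  H :=
    { Adj := fun x y => (x.1 = y.1 ∧ x.2 ≠ y.2) ∨ (G.Adj x.1 y.1 ∧ τ x.1 y.1 x.2 = y.2)
      symm := ⟨by
        rintro ⟨u, a⟩ ⟨v, b⟩ (⟨h, h'⟩ | ⟨h, h'⟩)
        · exact Or.inl ⟨h.symm, h'.symm⟩
        · exact Or.inr ⟨h.symm, by simp only at h' ⊢; rw [hτ, ← h']; simp⟩⟩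
      loopless := ⟨by
        rintro ⟨u, a⟩ (⟨-, h⟩ | ⟨h, -⟩)
        · exact h rfl
        · exact h.ne rfl⟩ }
  L v := {x | x.1 = v}
  nonempty v := ⟨(v, ⟨0, hm⟩), rfl⟩
  partition x := ⟨x.1, rfl, fun v h => h.symm⟩
  clique v := by
    rintro ⟨u, a⟩ rfl ⟨v, b⟩ hv hne
    obtain rfl : v = u := hv
    exact Or.inl ⟨rfl, fun h => hne (by simp_all)⟩
  adj_of_cross := by
    rintro u v x rfl y rfl (⟨h, -⟩ | ⟨h, -⟩)
    · exact Or.inl h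
    · exact Or.inr h
  matching := by
    rintro u v huv ⟨u, a⟩ rfl ⟨v, b⟩ rfl ⟨w, c⟩ hw h₁ h₂
    obtain rfl : w = v := hw
    rcases h₁ with ⟨h, -⟩ | ⟨-, h₁⟩
    · exact absurd h huv.ne
    rcases h₂ with ⟨h, -⟩ | ⟨-, h₂⟩
    · exact absurd h huv.ne
    · exact Prod.ext rfl (h₁.symm.trans h₂)

theorem isFold_ofPerm [Finite V] {m : ℕ} (hm : 1 ≤ m) (τ : V → V → Perm (Fin m))
    (hτ : ∀ u v, τ v u = (τ u v)⁻¹) : (ofPerm G hm τ hτ).IsFold m := by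
  intro v
  have : {x : V × Fin m | x.1 = v} = Set.range (fun j : Fin m => (v, j)) := by
    ext ⟨a, b⟩
    simp [eq_comm]
  change Set.ncard {x : V × Fin m | x.1 = v} = m
  rw [this, ← Set.image_univ, Set.ncard_image_of_injective _ (Prod.mk_right_injective v)]
  simp

theorem numColorings_ofPerm [Finite V] {m : ℕ} (hm : 1 ≤ m) (τ : V → V → Perm (Fin m))
    (hτ : ∀ u v, τ v u = (τ u v)⁻¹) : (ofPerm G hm τ hτ).numColorings =
      {c : V → Fin m | ∀ u v, G.Adj u v → τ u v (c u) ≠ c v}.ncard := by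
  have hinj : Function.Injective fun (c : V → Fin m) v => (v, c v) := fun c d h => by
    ext v
    exact congrArg (fun x : V × Fin m => x.2.1) (congrFun h v)
  rw [numColorings_eq, ← Set.ncard_image_of_injective _ hinj]
  congr 1
  ext c
  constructor
  · rintro ⟨hc, hc'⟩
    have hc₁ : ∀ v, (c v).1 = v := hc
    refine ⟨fun v => (c v).2, fun u v huv h => hc' u v huv (Or.inr ?_),
      funext fun v => Prod.ext (hc v).symm rfl⟩
    rw [hc₁, hc₁]
    exact ⟨huv, h⟩
  · rintro ⟨c, hc, rfl⟩
    refine ⟨fun v => rfl, ?_⟩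
    rintro u v huv (⟨h, -⟩ | ⟨-, h⟩)
    · exact huv.ne h
    · exact hc u v huv h

end Cover

/-! ### Covers of Theta graphs versus families of permutations -/

section Theta

variable {l : Fin 3 → ℕ}

/-- The relation of which the Theta graph is the symmetrization. -/
def ThetaStep (l : Fin 3 → ℕ) (x y : ThetaVertex l) : Prop :=
  ∃ i, ∃ j < l i, x = thetaPoint l i j ∧ y = thetaPoint l i (j + 1)

theorem thetaPoint_ne (hl : ∀ i, 2 ≤ l i) (i : Fin 3) (j : ℕ) (hj : j < l i) :
    thetaPoint l i j ≠ thetaPoint l i (j + 1) := by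
  have := hl i
  unfold thetaPoint
  split_ifs <;> simp <;> omega

/-- The matchings which are `π i` on the first edge of the `i`-th path and trivial elsewhere. -/
def headPerm {m : ℕ} (π : Fin 3 → Perm (Fin m)) (i : Fin 3) (j : ℕ) : Perm (Fin m) :=
  if j = 0 then π i else 1

/-- The matchings of `headPerm`, as a function of the ends of an edge. -/
def thetaTwist {m : ℕ} (π : Fin 3 → Perm (Fin m)) : ThetaVertex l → ThetaVertex l → Perm (Fin m)
  | Sum.inl false, Sum.inr k => π k.1
  | Sum.inr k, Sum.inl false => (π k.1)⁻¹
  | _, _ => 1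

theorem thetaTwist_symm {m : ℕ} (π : Fin 3 → Perm (Fin m)) (x y : ThetaVertex l) :
    thetaTwist π y x = (thetaTwist π x y)⁻¹ := by
  rcases x with (_ | _) | _ <;> rcases y with (_ | _) | _ <;> simp [thetaTwist]

/-- Since `2 ≤ l i`, the first edge of a path ends at an internal vertex, which reveals the index
`i`. -/
theorem thetaTwist_thetaPoint (hl : ∀ i, 2 ≤ l i) {m : ℕ} (π : Fin 3 → Perm (Fin m))
    (i : Fin 3) (j : ℕ) :
    thetaTwist π (thetaPoint l i j) (thetaPoint l i (j + 1)) = headPerm π i j := by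
  have := hl i
  rcases j with _ | j
  · have h : 0 < l i - 1 := by omega
    simp [thetaPoint, h, thetaTwist, headPerm]
  · simp only [thetaPoint, headPerm]
    split_ifs <;> first | omega | contradiction | rfl

variable {V : Type u} {G : SimpleGraph V}

/-- The colorings of a cover twisted on the first edges of the paths are the corresponding
colorings of the Theta graph. -/
theorem ncard_twisted_colorings (hl : ∀ i, 2 ≤ l i)
    (φ : G ≃g SimpleGraph.fromRel (ThetaStep l)) {m : ℕ} (π : Fin 3 → Perm (Fin m)) :
    {c : V → Fin m | ∀ u v, G.Adj u v → thetaTwist π (φ u) (φ v) (c u) ≠ c v}.ncard =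
      (thetaColorings l (headPerm π)).ncard := by
  have hinj : Function.Injective fun (c : ThetaVertex l → Fin m) v => c (φ v) :=
    φ.surjective.injective_comp_right
  rw [← Set.ncard_image_of_injective _ hinj]
  congr 1
  ext c
  constructor
  · intro hc
    refine ⟨fun x => c (φ.symm x), fun i j hj => ?_, by simp⟩
    have := hc (φ.symm (thetaPoint l i j)) (φ.symm (thetaPoint l i (j + 1))) (by
      rw [← φ.map_adj_iff, φ.apply_symm_apply, φ.apply_symm_apply, SimpleGraph.fromRel_adj]
      exact ⟨thetaPoint_ne hl i j hj, Or.inl ⟨i, j, hj, rfl, rfl⟩⟩)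
    rwa [φ.apply_symm_apply, φ.apply_symm_apply, thetaTwist_thetaPoint hl] at this
  · rintro ⟨c, hc, rfl⟩ u v huv
    rw [← φ.map_adj_iff, SimpleGraph.fromRel_adj] at huv
    have key : ∀ x y, ThetaStep l x y → thetaTwist π x y (c x) ≠ c y := by
      rintro x y ⟨i, j, hj, rfl, rfl⟩
      rw [thetaTwist_thetaPoint hl]
      exact hc i j hj
    rcases huv.2 with h | h
    · exact key _ _ h
    · have := key _ _ h
      rw [thetaTwist_symm, ne_eq, Perm.inv_eq_iff_eq] at this
      exact fun h => this h.symm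

/-- Every cover has at least as many colorings as some family of permutations. -/
theorem exists_ncard_thetaColorings_le [Finite V]
    (φ : G ≃g SimpleGraph.fromRel (ThetaStep l)) {m : ℕ} (C : Cover G) (hC : C.IsFold m) :
    ∃ σ : Fin 3 → ℕ → Perm (Fin m), (thetaColorings l σ).ncard ≤ C.numColorings := by
  have := C.finite_W
  have he : ∀ v, Nonempty (Fin m ≃ C.L v) := fun v => by
    refine ⟨(Finite.equivFinOfCardEq ?_).symm⟩
    rw [Nat.card_coe_set_eq, hC v]
  let e : ∀ v, Fin m ≃ C.L v := fun v => (he v).some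
  have hex : ∀ u v, ∃ σ : Perm (Fin m), ∀ a b,
      G.Adj u v ∧ C.H.Adj (e u a).1 (e v b).1 → σ a = b := fun u v => by
    refine exists_perm_of_matching _ ?_ ?_
    · rintro a b c ⟨huv, hb⟩ ⟨-, hc⟩
      exact (e v).injective (Subtype.ext
        (C.matching u v huv _ (e u a).2 _ (e v b).2 _ (e v c).2 hb hc))
    · rintro a b c ⟨huv, ha⟩ ⟨-, hb⟩
      exact (e u).injective (Subtype.ext
        (C.matching v u huv.symm _ (e v c).2 _ (e u a).2 _ (e u b).2 ha.symm hb.symm))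
  choose σ hσ using hex
  -- `σ u v` and `σ v u` were chosen independently and need not be inverse; each edge is used only
  -- in its direction along the path.
  refine ⟨fun i j => σ (φ.symm (thetaPoint l i j)) (φ.symm (thetaPoint l i (j + 1))), ?_⟩
  rw [Cover.numColorings_eq]
  refine Set.ncard_le_ncard_of_injOn (fun c v => (e v (c (φ v))).1) ?_ ?_ (Set.toFinite _)
  · intro c hc
    refine ⟨fun v => (e v _).2, fun u v huv hadj => ?_⟩
    have key : ∀ u v, G.Adj u v → ThetaStep l (φ u) (φ v) →
        ¬ C.H.Adj (e u (c (φ u))).1 (e v (c (φ v))).1 := by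
      rintro u v huv ⟨i, j, hj, hu, hv⟩ h
      have := hc i j hj
      simp only [← hu, ← hv, φ.symm_apply_apply] at this
      exact this (hσ u v _ _ ⟨huv, h⟩)
    have huv' := huv
    rw [← φ.map_adj_iff, SimpleGraph.fromRel_adj] at huv'
    rcases huv'.2 with h | h
    · exact key u v huv h hadj
    · exact key v u huv.symm h hadj.symm
  · intro c _ d _ hcd
    ext x : 1
    have h := congrFun hcd (φ.symm x)
    simpa using (e _).injective (Subtype.ext h)

end Theta

/-! ### Comparison of path counts by length and parity -/

section Bounds

variable {m : ℕ}

theorem neg_one_pow_eq_neg {j k : ℕ} (h : ¬ (Even j ↔ Even k)) :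
    (-1 : ℤ) ^ k = -(-1) ^ j := by
  rcases Nat.even_or_odd j with hj | hj <;> rcases Nat.even_or_odd k with hk | hk
  · exact absurd (iff_of_true hj hk) h
  · simp [hj.neg_one_pow, hk.neg_one_pow]
  · simp [hj.neg_one_pow, hk.neg_one_pow]
  · exact absurd (iff_of_false (by simpa using hj) (by simpa using hk)) h

theorem unmatchedCount_nonneg (hm : 2 ≤ m) (k : ℕ) : 0 ≤ unmatchedCount m k := by
  have hm' : (1 : ℤ) ≤ m - 1 := by omega
  refine nonneg_of_mul_nonneg_right (a := (m : ℤ)) ?_ (by omega)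
  rw [mul_unmatchedCount]
  have := one_le_pow₀ hm' (n := k)
  rcases neg_one_pow_eq_or ℤ k with h | h <;> rw [h] <;> omega

theorem matchedCount_nonneg (hm : 2 ≤ m) {k : ℕ} (hk : 1 ≤ k) :
    0 ≤ unmatchedCount m k + (-1) ^ k := by
  have hm' : (1 : ℤ) ≤ m - 1 := by omega
  refine nonneg_of_mul_nonneg_right (a := (m : ℤ)) ?_ (by omega)
  rw [mul_add, mul_unmatchedCount]
  have := le_self_pow₀ hm' (by omega : k ≠ 0)
  rcases neg_one_pow_eq_or ℤ k with h | h <;> rw [h] <;> omega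

theorem unmatchedCount_le (hm : 2 ≤ m) {j k : ℕ} (hjk : j ≤ k) (h : Even j ↔ Even k) :
    unmatchedCount m j ≤ unmatchedCount m k := by
  have hm' : (1 : ℤ) ≤ m - 1 := by omega
  refine le_of_mul_le_mul_left (a := (m : ℤ)) ?_ (by omega)
  rw [mul_unmatchedCount, mul_unmatchedCount, neg_one_pow_congr h]
  have := pow_le_pow_right₀ hm' hjk
  omega

/-- The difference is at least `(m - 2) * (m - 1) ^ j`. After multiplication by `m`, both
comparisons between lengths of opposite parity reduce to this bound. -/
theorem le_pow_sub_pow (hm : 2 ≤ m) {j k : ℕ} (hjk : j < k) :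
    (m : ℤ) - 2 ≤ (m - 1) ^ k - (m - 1) ^ j := by
  have hm' : (1 : ℤ) ≤ m - 1 := by omega
  have h₁ := one_le_pow₀ hm' (n := j)
  have h₂ := pow_le_pow_right₀ hm' (show j + 1 ≤ k from hjk)
  rw [pow_succ] at h₂
  nlinarith

theorem lt_of_not_even_iff {j k : ℕ} (hjk : j ≤ k) (h : ¬ (Even j ↔ Even k)) : j < k :=
  hjk.lt_of_ne fun e => h (by rw [e])

theorem matchedCount_le (hm : 2 ≤ m) {j k : ℕ} (hjk : j ≤ k) (h : ¬ (Even j ↔ Even k)) :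
    unmatchedCount m j + (-1) ^ j ≤ unmatchedCount m k := by
  refine le_of_mul_le_mul_left (a := (m : ℤ)) ?_ (by omega)
  rw [mul_add, mul_unmatchedCount, mul_unmatchedCount, neg_one_pow_eq_neg h]
  have := le_pow_sub_pow hm (lt_of_not_even_iff hjk h)
  rcases neg_one_pow_eq_or ℤ j with h | h <;> rw [h] <;> omega

theorem unmatchedCount_le_matchedCount (hm : 2 ≤ m) {j k : ℕ} (hjk : j ≤ k)
    (h : ¬ (Even j ↔ Even k)) : unmatchedCount m j ≤ unmatchedCount m k + (-1) ^ k := by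
  refine le_of_mul_le_mul_left (a := (m : ℤ)) ?_ (by omega)
  rw [mul_add, mul_unmatchedCount, mul_unmatchedCount, neg_one_pow_eq_neg h]
  have := le_pow_sub_pow hm (lt_of_not_even_iff hjk h)
  rcases neg_one_pow_eq_or ℤ j with h | h <;> rw [h] <;> omega

end Bounds

/-! ### Optimal coincidence patterns and the four formulas -/

section DPValue

theorem finRotate_apply_ne {m : ℕ} (hm : 2 ≤ m) (a : Fin m) : finRotate m a ≠ a := by
  obtain ⟨k, rfl⟩ := Nat.exists_eq_add_of_le' hm
  simp

theorem finRotate_finRotate_apply_ne {m : ℕ} (hm : 3 ≤ m) (a : Fin m) :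
    finRotate m (finRotate m a) ≠ a := by
  obtain ⟨k, rfl⟩ := Nat.exists_eq_add_of_le' hm
  have h : (2 : ℕ) % (k + 3) = 2 := Nat.mod_eq_of_lt (by omega)
  rw [finRotate_apply, finRotate_apply, add_assoc, ne_eq, add_eq_left]
  simp [Fin.ext_iff, Fin.val_add, h]

variable {l : Fin 3 → ℕ} {V : Type u} {G : SimpleGraph V} {m : ℕ}

/-- The number of colorings with a given color at the first end, if this color is matched to the
color `x i` of the second end along the `i`-th path. -/
def endWeight (l : Fin 3 → ℕ) (x : Fin 3 → Fin m) : ℤ :=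
  ∑ b, ∏ i, (unmatchedCount m (l i) + (-1) ^ l i * if x i = b then 1 else 0)

theorem ncard_thetaColorings_headPerm (hl : ∀ i, 2 ≤ l i) (π : Fin 3 → Perm (Fin m)) :
    ((thetaColorings l (headPerm π)).ncard : ℤ) = ∑ a, endWeight l fun i => π i a := by
  rw [ncard_thetaColorings fun i => one_le_two.trans (hl i)]
  have h : ∀ i, pathPerm (l i) (headPerm π i) = π i := fun i => by
    obtain ⟨k, hk⟩ := Nat.exists_eq_add_of_le (one_le_two.trans (hl i))
    rw [hk, add_comm, pathPerm_eq_head]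
    · rfl
    · intro j
      simp [headPerm]
  simp only [h, endWeight]

theorem dpColorFunction_eq [Finite V] (hl : ∀ i, 2 ≤ l i)
    (φ : G ≃g SimpleGraph.fromRel (ThetaStep l)) (hm : 1 ≤ m) (K : ℤ)
    (hK : ∀ x : Fin 3 → Fin m, K ≤ endWeight l x) (π : Fin 3 → Perm (Fin m))
    (hπ : ∀ a, endWeight l (fun i => π i a) = K) : (dpColorFunction G m : ℤ) = m * K := by
  have hN : ((thetaColorings l (headPerm π)).ncard : ℤ) = m * K := by
    simp [ncard_thetaColorings_headPerm hl, hπ]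
  have hleast := dpColorFunction_isLeast G m hm
  refine le_antisymm ?_ ?_
  · rw [← hN, Nat.cast_le]
    refine hleast.2 ⟨Cover.ofPerm G hm (fun u v => thetaTwist π (φ u) (φ v))
      fun u v => thetaTwist_symm π _ _, Cover.isFold_ofPerm hm _ _, ?_⟩
    rw [Cover.numColorings_ofPerm, ncard_twisted_colorings hl φ]
  · obtain ⟨C, hC, hCn⟩ := hleast.1
    obtain ⟨σ, hσ⟩ := exists_ncard_thetaColorings_le φ C hC
    rw [← hCn]
    refine le_trans ?_ (Nat.cast_le.2 hσ)
    rw [ncard_thetaColorings fun i => one_le_two.trans (hl i)]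
    refine le_trans ?_ (Finset.sum_le_sum fun a _ => hK fun i => pathPerm (l i) (σ i) a)
    simp

theorem chromaticPolynomial_eq (hl : ∀ i, 2 ≤ l i)
    (φ : G ≃g SimpleGraph.fromRel (ThetaStep l)) (m : ℕ) :
    (chromaticPolynomial G m : ℤ) = ∑ a : Fin m, endWeight l fun _ => a := by
  have h := ncard_thetaColorings_headPerm hl (1 : Fin 3 → Perm (Fin m))
  rw [← ncard_twisted_colorings hl φ] at h
  refine Eq.trans ?_ h
  have htwist : ∀ x y, thetaTwist (l := l) (1 : Fin 3 → Perm (Fin m)) x y = 1 := by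
    rintro ((_ | _) | _) ((_ | _) | _) <;> simp [thetaTwist]
  rw [← Nat.card_coe_set_eq, chromaticPolynomial, Nat.cast_inj]
  refine Nat.card_congr
    { toFun := fun c => ⟨c, fun u v huv => ?_⟩
      invFun := fun c => SimpleGraph.Coloring.mk c.1 fun {u v} huv => ?_
      left_inv := fun c => rfl
      right_inv := fun c => rfl }
  · rw [htwist]
    exact c.valid huv
  · have := c.2 u v huv
    rwa [htwist] at this

theorem chromaticPolynomial_one {u v : V} (h : G.Adj u v) : chromaticPolynomial G 1 = 0 := by
  have : IsEmpty (G.Coloring (Fin 1)) := ⟨fun c => c.valid h (Subsingleton.elim _ _)⟩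
  exact Nat.card_of_isEmpty

theorem dpColorFunction_le_chromaticPolynomial [Finite V] (hl : ∀ i, 2 ≤ l i)
    (φ : G ≃g SimpleGraph.fromRel (ThetaStep l)) (hm : 1 ≤ m) :
    dpColorFunction G m ≤ chromaticPolynomial G m := by
  have h : (chromaticPolynomial G m : ℤ) =
      (thetaColorings l (headPerm (1 : Fin 3 → Perm (Fin m)))).ncard := by
    rw [chromaticPolynomial_eq hl φ, ncard_thetaColorings_headPerm hl]
    rfl
  rw [Nat.cast_inj] at h
  rw [h]
  refine (dpColorFunction_isLeast G m hm).2 ⟨Cover.ofPerm G hm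
    (fun u v => thetaTwist 1 (φ u) (φ v)) fun u v => thetaTwist_symm 1 _ _,
    Cover.isFold_ofPerm hm _ _, ?_⟩
  rw [Cover.numColorings_ofPerm, ncard_twisted_colorings hl φ]

theorem dpColorFunction_eq_chromaticPolynomial [Finite V] (hl : ∀ i, 2 ≤ l i)
    (φ : G ≃g SimpleGraph.fromRel (ThetaStep l)) (h₀₁ : l 0 ≤ l 1) (h₀₂ : l 0 ≤ l 2)
    (p₀₁ : ¬ (Even (l 0) ↔ Even (l 1))) (p₀₂ : ¬ (Even (l 0) ↔ Even (l 2))) (hm : 1 ≤ m) :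
    dpColorFunction G m = chromaticPolynomial G m := by
  obtain rfl | hm₂ := hm.eq_or_lt
  -- The bounds on path counts need `m ≥ 2`; for `m = 1` one edge makes both sides zero.
  · have h : G.Adj (φ.symm (thetaPoint l 0 0)) (φ.symm (thetaPoint l 0 1)) := by
      have h₀ : 0 < l 0 := zero_lt_two.trans_le (hl 0)
      rw [← φ.map_adj_iff, φ.apply_symm_apply, φ.apply_symm_apply, SimpleGraph.fromRel_adj]
      exact ⟨thetaPoint_ne hl 0 0 h₀, Or.inl ⟨0, 0, h₀, rfl, rfl⟩⟩
    have := dpColorFunction_le_chromaticPolynomial (m := 1) hl φ le_rfl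
    rw [chromaticPolynomial_one h] at this ⊢
    omega
  have hconst : ∀ a b : Fin m, endWeight l (fun _ => a) = endWeight l fun _ => b := by
    simp only [endWeight, sum_prod_add_mul_ite, implies_true]
  let o : Fin m := ⟨0, hm⟩
  have := dpColorFunction_eq hl φ hm (endWeight l fun _ => o) (fun x => ?_) 1 fun a => hconst a o
  · rw [← Nat.cast_inj (R := ℤ), this, chromaticPolynomial_eq hl φ,
      Finset.sum_congr rfl fun a _ => hconst a o]
    simp
  simp only [endWeight, sum_prod_add_mul_ite, neg_one_pow_eq_neg p₀₁, neg_one_pow_eq_neg p₀₂]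
  -- With `B i` for path `i`, the corrections are `-B 2`, `-B 1`, `B 0` for single coincidences and
  -- `B 0 - B 1 - B 2 + s 0` for all equal. The last is least because `B 0 + s 0` is at most `B 1`
  -- and `B 2`.
  have u₀ := unmatchedCount_nonneg hm₂ (l 0)
  have u₁ := unmatchedCount_nonneg hm₂ (l 1)
  have u₂ := unmatchedCount_nonneg hm₂ (l 2)
  have b₁ := matchedCount_le hm₂ h₀₁ p₀₁
  have b₂ := matchedCount_le hm₂ h₀₂ p₀₂
  rcases neg_one_pow_eq_or ℤ (l 0) with s | s <;> rw [s] at b₁ b₂ ⊢ <;> split_ifs <;>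
    first | linarith | grind

theorem dpColorFunction_eq_of_even_iff_snd [Finite V] (hl : ∀ i, 2 ≤ l i)
    (φ : G ≃g SimpleGraph.fromRel (ThetaStep l)) (h₀₁ : l 0 ≤ l 1) (h₀₂ : l 0 ≤ l 2)
    (p₀₁ : Even (l 0) ↔ Even (l 1)) (p₀₂ : ¬ (Even (l 0) ↔ Even (l 2))) (hm : 2 ≤ m) :
    (dpColorFunction G m : ℚ) = 1 / (m : ℚ) * (((m : ℚ) - 1) ^ (l 0 + l 1 + l 2)
      + ((m : ℚ) - 1) ^ l 0 - ((m : ℚ) - 1) ^ (l 1 + 1) - ((m : ℚ) - 1) ^ l 2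
      + (-1) ^ (l 2 + 1) * ((m : ℚ) - 2)) := by
  have key := dpColorFunction_eq hl φ (m := m) (by omega)
    (m * (unmatchedCount m (l 0) * unmatchedCount m (l 1) * unmatchedCount m (l 2))
      + (-1) ^ l 0 * unmatchedCount m (l 1) * unmatchedCount m (l 2)
      + (-1) ^ l 1 * unmatchedCount m (l 0) * unmatchedCount m (l 2)
      + (-1) ^ l 2 * unmatchedCount m (l 0) * unmatchedCount m (l 1) - unmatchedCount m (l 1))
    (fun x => by
      simp only [endWeight, sum_prod_add_mul_ite, ← neg_one_pow_congr p₀₁,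
        neg_one_pow_eq_neg p₀₂]
      -- The corrections are `B 2`, `-B 1`, `-B 0`, and `B 2 + s 2 - B 0 - B 1` for all equal. Here
      -- `b₁` puts `-B 1` below `-B 0`, and `b₂` puts it below the last one.
      have u₀ := unmatchedCount_nonneg hm (l 0)
      have u₁ := unmatchedCount_nonneg hm (l 1)
      have u₂ := unmatchedCount_nonneg hm (l 2)
      have b₁ := unmatchedCount_le hm h₀₁ p₀₁
      have b₂ := unmatchedCount_le_matchedCount hm h₀₂ p₀₂
      rw [neg_one_pow_eq_neg p₀₂] at b₂
      rcases neg_one_pow_eq_or ℤ (l 0) with s | s <;> rw [s] at b₂ ⊢ <;> split_ifs <;>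
        first | linarith | grind)
    ![1, finRotate m, 1] (fun a => by
      have h := finRotate_apply_ne hm a
      have s : (-1 : ℤ) ^ l 0 * (-1) ^ l 0 = 1 := by rw [← mul_pow]; simp
      simp only [endWeight, sum_prod_add_mul_ite, ← neg_one_pow_congr p₀₁, neg_one_pow_eq_neg p₀₂]
      simp [h, h.symm, -finRotate_apply]
      linear_combination (-unmatchedCount m (l 1)) * s)
  have hm₀ : (m : ℚ) ≠ 0 := by positivity
  have e : ∀ i, (unmatchedCount m (l i) : ℚ) = ((m - 1) ^ l i - (-1) ^ l i) / m := fun i => by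
    rw [eq_div_iff hm₀, mul_comm]
    exact_mod_cast mul_unmatchedCount m (l i)
  have s₁ : (-1 : ℚ) ^ l 1 = (-1) ^ l 0 := (neg_one_pow_congr p₀₁).symm
  have s₂ : (-1 : ℚ) ^ l 2 = -(-1) ^ l 0 := by exact_mod_cast neg_one_pow_eq_neg p₀₂
  rw [← Int.cast_natCast (dpColorFunction G m), key]
  push_cast
  simp only [e, pow_add, s₁, s₂, pow_one]
  rcases neg_one_pow_eq_or ℚ (l 0) with s | s <;> rw [s] <;> field_simp <;> ring

theorem dpColorFunction_eq_of_even_iff_thd [Finite V] (hl : ∀ i, 2 ≤ l i)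
    (φ : G ≃g SimpleGraph.fromRel (ThetaStep l)) (h₀₁ : l 0 ≤ l 1) (h₀₂ : l 0 ≤ l 2)
    (p₀₂ : Even (l 0) ↔ Even (l 2)) (p₀₁ : ¬ (Even (l 0) ↔ Even (l 1))) (hm : 2 ≤ m) :
    (dpColorFunction G m : ℚ) = 1 / (m : ℚ) * (((m : ℚ) - 1) ^ (l 0 + l 1 + l 2)
      + ((m : ℚ) - 1) ^ l 0 - ((m : ℚ) - 1) ^ (l 2 + 1) - ((m : ℚ) - 1) ^ l 1
      + (-1) ^ (l 1 + 1) * ((m : ℚ) - 2)) := by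
  have key := dpColorFunction_eq hl φ (m := m) (by omega)
    (m * (unmatchedCount m (l 0) * unmatchedCount m (l 1) * unmatchedCount m (l 2))
      + (-1) ^ l 0 * unmatchedCount m (l 1) * unmatchedCount m (l 2)
      + (-1) ^ l 1 * unmatchedCount m (l 0) * unmatchedCount m (l 2)
      + (-1) ^ l 2 * unmatchedCount m (l 0) * unmatchedCount m (l 1) - unmatchedCount m (l 2))
    (fun x => by
      simp only [endWeight, sum_prod_add_mul_ite, ← neg_one_pow_congr p₀₂,
        neg_one_pow_eq_neg p₀₁]
      have u₀ := unmatchedCount_nonneg hm (l 0)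
      have u₁ := unmatchedCount_nonneg hm (l 1)
      have u₂ := unmatchedCount_nonneg hm (l 2)
      have b₁ := unmatchedCount_le_matchedCount hm h₀₁ p₀₁
      have b₂ := unmatchedCount_le hm h₀₂ p₀₂
      rw [neg_one_pow_eq_neg p₀₁] at b₁
      rcases neg_one_pow_eq_or ℤ (l 0) with s | s <;> rw [s] at b₁ ⊢ <;> split_ifs <;>
        first | linarith | grind)
    -- A fixed-point-free third permutation gives `x 0 = x 1 ≠ x 2` at every `a`.
    ![1, 1, finRotate m] (fun a => by
      have h := finRotate_apply_ne hm a
      have s : (-1 : ℤ) ^ l 0 * (-1) ^ l 0 = 1 := by rw [← mul_pow]; simp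
      simp only [endWeight, sum_prod_add_mul_ite, ← neg_one_pow_congr p₀₂, neg_one_pow_eq_neg p₀₁]
      simp [h.symm, -finRotate_apply]
      linear_combination (-unmatchedCount m (l 2)) * s)
  have hm₀ : (m : ℚ) ≠ 0 := by positivity
  have e : ∀ i, (unmatchedCount m (l i) : ℚ) = ((m - 1) ^ l i - (-1) ^ l i) / m := fun i => by
    rw [eq_div_iff hm₀, mul_comm]
    exact_mod_cast mul_unmatchedCount m (l i)
  have s₁ : (-1 : ℚ) ^ l 1 = -(-1) ^ l 0 := by exact_mod_cast neg_one_pow_eq_neg p₀₁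
  have s₂ : (-1 : ℚ) ^ l 2 = (-1) ^ l 0 := (neg_one_pow_congr p₀₂).symm
  rw [← Int.cast_natCast (dpColorFunction G m), key]
  push_cast
  simp only [e, pow_add, s₁, s₂, pow_one]
  rcases neg_one_pow_eq_or ℚ (l 0) with s | s <;> rw [s] <;> field_simp <;> ring

theorem dpColorFunction_eq_of_even_iff [Finite V] (hl : ∀ i, 2 ≤ l i)
    (φ : G ≃g SimpleGraph.fromRel (ThetaStep l)) (p₀₁ : Even (l 0) ↔ Even (l 1))
    (p₀₂ : Even (l 0) ↔ Even (l 2)) (hm : 3 ≤ m) :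
    (dpColorFunction G m : ℚ) = 1 / (m : ℚ) * (((m : ℚ) - 1) ^ (l 0 + l 1 + l 2)
      - ((m : ℚ) - 1) ^ l 0 - ((m : ℚ) - 1) ^ l 1 - ((m : ℚ) - 1) ^ l 2
      + 2 * (-1) ^ (l 0 + l 1 + l 2)) := by
  have hm₂ : 2 ≤ m := by omega
  have key := dpColorFunction_eq hl φ (m := m) (by omega)
    (m * (unmatchedCount m (l 0) * unmatchedCount m (l 1) * unmatchedCount m (l 2))
      + (-1) ^ l 0 * unmatchedCount m (l 1) * unmatchedCount m (l 2)
      + (-1) ^ l 1 * unmatchedCount m (l 0) * unmatchedCount m (l 2)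
      + (-1) ^ l 2 * unmatchedCount m (l 0) * unmatchedCount m (l 1))
    (fun x => by
      simp only [endWeight, sum_prod_add_mul_ite, ← neg_one_pow_congr p₀₁,
        ← neg_one_pow_congr p₀₂]
      -- All products `s i * s j` are `1`, so no coincidence lowers the weight; `b` absorbs the
      -- possibly negative triple term.
      have u₀ := unmatchedCount_nonneg hm₂ (l 0)
      have u₁ := unmatchedCount_nonneg hm₂ (l 1)
      have u₂ := unmatchedCount_nonneg hm₂ (l 2)
      have b := matchedCount_nonneg hm₂ (one_le_two.trans (hl 0))
      rcases neg_one_pow_eq_or ℤ (l 0) with s | s <;> rw [s] at b ⊢ <;> split_ifs <;>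
        first | linarith | grind)
    -- The images of `a` under rotation by 0, 1 and 2 are pairwise distinct because `m ≥ 3`.
    ![1, finRotate m, finRotate m * finRotate m] (fun a => by
      simp only [endWeight, sum_prod_add_mul_ite]
      simp [(finRotate_apply_ne hm₂ a).symm, (finRotate_apply_ne hm₂ _).symm,
        (finRotate_finRotate_apply_ne hm a).symm, -finRotate_apply])
  have hm₀ : (m : ℚ) ≠ 0 := by positivity
  have e : ∀ i, (unmatchedCount m (l i) : ℚ) = ((m - 1) ^ l i - (-1) ^ l i) / m := fun i => by
    rw [eq_div_iff hm₀, mul_comm]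
    exact_mod_cast mul_unmatchedCount m (l i)
  have s₁ : (-1 : ℚ) ^ l 1 = (-1) ^ l 0 := (neg_one_pow_congr p₀₁).symm
  have s₂ : (-1 : ℚ) ^ l 2 = (-1) ^ l 0 := (neg_one_pow_congr p₀₂).symm
  rw [← Int.cast_natCast (dpColorFunction G m), key]
  push_cast
  simp only [e, pow_add, s₁, s₂]
  rcases neg_one_pow_eq_or ℚ (l 0) with s | s <;> rw [s] <;> field_simp <;> ring

end DPValue

end DPColoring

open DPColoring in
theorem theorem1p3 {V : Type u} (G : SimpleGraph V) (l₁ l₂ l₃ : ℕ)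
    (hG : Nonempty (G ≃g thetaGraph l₁ l₂ l₃))
    (h₁ : 2 ≤ l₁) (h₁₂ : l₁ ≤ l₂) (h₂₃ : l₂ ≤ l₃) :
    (¬ (Even l₁ ↔ Even l₂) → ¬ (Even l₁ ↔ Even l₃) →
      ∀ m : ℕ, 1 ≤ m → dpColorFunction G m = chromaticPolynomial G m) ∧
    ((Even l₁ ↔ Even l₂) → ¬ (Even l₁ ↔ Even l₃) →
      ∀ m : ℕ, 2 ≤ m → (dpColorFunction G m : ℚ) =
        1 / (m : ℚ) * (((m : ℚ) - 1) ^ (l₁ + l₂ + l₃) + ((m : ℚ) - 1) ^ l₁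
          - ((m : ℚ) - 1) ^ (l₂ + 1) - ((m : ℚ) - 1) ^ l₃
          + (-1) ^ (l₃ + 1) * ((m : ℚ) - 2))) ∧
    ((Even l₁ ↔ Even l₃) → ¬ (Even l₁ ↔ Even l₂) →
      ∀ m : ℕ, 2 ≤ m → (dpColorFunction G m : ℚ) =
        1 / (m : ℚ) * (((m : ℚ) - 1) ^ (l₁ + l₂ + l₃) + ((m : ℚ) - 1) ^ l₁
          - ((m : ℚ) - 1) ^ (l₃ + 1) - ((m : ℚ) - 1) ^ l₂
          + (-1) ^ (l₂ + 1) * ((m : ℚ) - 2))) ∧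
    ((Even l₁ ↔ Even l₂) → (Even l₁ ↔ Even l₃) →
      ∀ m : ℕ, 3 ≤ m → (dpColorFunction G m : ℚ) =
        1 / (m : ℚ) * (((m : ℚ) - 1) ^ (l₁ + l₂ + l₃) - ((m : ℚ) - 1) ^ l₁
          - ((m : ℚ) - 1) ^ l₂ - ((m : ℚ) - 1) ^ l₃
          + 2 * (-1) ^ (l₁ + l₂ + l₃))) := by
  obtain ⟨φ⟩ := hG
  have : Finite V := Finite.of_equiv _ φ.symm.toEquiv
  have hl : ∀ i, 2 ≤ ![l₁, l₂, l₃] i := by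
    intro i
    fin_cases i <;> simp <;> omega
  have h₁₃ := h₁₂.trans h₂₃
  exact ⟨fun p q m hm => dpColorFunction_eq_chromaticPolynomial hl φ h₁₂ h₁₃ p q hm,
    fun p q m hm => dpColorFunction_eq_of_even_iff_snd hl φ h₁₂ h₁₃ p q hm,
    fun p q m hm => dpColorFunction_eq_of_even_iff_thd hl φ h₁₂ h₁₃ p q hm,
    fun p q m hm => dpColorFunction_eq_of_even_iff hl φ p q hm⟩
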